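/- **Setting.** Let $\mathbb K\in\{\mathbb R,\mathbb C\}$, let $\Omega$ be a Hausdorff space, $\mathcal C(\Omega)$ the space of continuous functions $\Omega\to\mathbb K$, and $\tau_{co}$ the compact-open topology. Let $\mathcal F\subset\mathcal C(\Omega)$ be a linear subspace with a norm $\|\cdot\|$ whose topology is finer than the relative topology $\tau_{co}$ on $\mathcal F$; that is, $(\mathcal F,\|\cdot\|,\tau_{co})$ is a pre-Saks space. The mixed topology $\gamma=\gamma(\|\cdot\|,\tau_{co})$ is the finest linear topology on $\mathcal F$ that coincides with $\tau_{co}$ on $\|\cdot\|$-bounded sets and satisfies $\tau_{co}\subset\gamma\subset\tau_{\|\cdot\|}$. The triple is a *Saks space* if there is a directed system $\Gamma$ of seminorms generating $\tau_{co}$ on $\mathcal F$ with $\|f\|=\sup_{p\in\Gamma}p(f)$ for all $f\in\mathcal F$. For such a $\Gamma$, the submixed topology $\gamma_s$ is generated by the seminorms $f\mapsto\sup_{n}a_np_n(f)$, where $p_n\in\Gamma$ and $(a_n)_{n\in\mathbb N}$ is a nonnegative null sequence. The triple is *sequentially complete* if every $\gamma$-Cauchy sequence $\gamma$-converges, and *C-sequential*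 if every convex sequentially $\gamma$-open subset of $\mathcal F$ is $\gamma$-open. Let $(m,\varphi)$ be a jointly continuous co-semiflow: $\varphi_t\colon\Omega\to\Omega$ and $m_t\colon\Omega\to\mathbb K$ ($t\ge0$) are continuous, the maps $(t,x)\mapsto\varphi_t(x)$ and $(t,x)\mapsto m_t(x)$ are continuous on $[0,\infty)\times\Omega$, and $$\varphi_0=\mathrm{id},\quad \varphi_{t+s}=\varphi_t\circ\varphi_s,\quad m_0=1,\quad m_{t+s}=m_t\cdot(m_s\circ\varphi_t)\qquad(t,s\ge0).$$ Assume that $C_{m,\varphi}(t)f:=m_t\cdot(f\circ\varphi_t)\in\mathcal F$ for all $t\ge0$, $f\in\mathcal F$, and that the semigroup $(C_{m,\varphi}(t))_{t\ge0}$ on $\mathcal F$ is locally bounded, i.e. $\sup_{t\in[0,t_0]}\|C_{m,\varphi}(t)\|_{\mathcal L(\mathcal F)}<\infty$ for all $t_0\ge0$. **Notions.** For a topology $\sigma$ on $\mathcal F$, a family $(T(t))_{t\in I}$ of linear maps $\mathcal F\to\mathcal F$ is *$\sigma$-equicontinuous* if for every $\sigma$-continuous seminorm $p$ there are a $\sigma$-continuous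 seminorm $q$ and $C\ge0$ with $p(T(t)f)\le Cq(f)$ for all $t\in I$, $f\in\mathcal F$. It is *$(\|\cdot\|,\tau_{co})$-equitight* if for every $\varepsilon>0$ and every $\tau_{co}$-continuous seminorm $p$ there are a $\tau_{co}$-continuous seminorm $q$ and $C\ge0$ with $p(T(t)f)\le Cq(f)+\varepsilon\|f\|$ for all $t\in I$, $f\in\mathcal F$. For a family $(T(t))_{t\ge0}$, "locally" means that the property holds for $(T(t))_{t\in[0,t_0]}$ for every $t_0\ge0$, and "quasi" that it holds for $(e^{-\omega t}T(t))_{t\ge0}$ for some $\omega\in\mathbb R$. The family $(T(t))_{t\ge0}$ is *$\gamma$-strongly continuous* if every $T(t)$ is $\gamma$-continuous and $t\mapsto T(t)f$ is $\gamma$-continuous on $[0,\infty)$ for every $f$. It is a *$\tau_{co}$-bi-continuous semigroup* if $T(0)=\mathrm{id}$, $T(t+s)=T(t)T(s)$ for all $t,s\ge0$, $\|T(t)\|_{\mathcal L(\mathcal F)}\le Me^{\omega t}$ for all $t\ge0$ with some $M\ge1$, $\omega\in\mathbb R$, every orbit $t\mapsto T(t)f$ is $\tau_{co}$-continuous, and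 for every $t_0\ge0$ and every $\|\cdot\|$-bounded sequence $(f_n)$ that $\tau_{co}$-converges to some $f\in\mathcal F$ one has $T(t)f_n-T(t)f\to0$ with respect to $\tau_{co}$, uniformly in $t\in[0,t_0]$. **Theorem.** (a) $(C_{m,\varphi}(t))_{t\ge0}$ is $\gamma$-strongly continuous, locally $\tau_{co}$-equicontinuous and locally $\gamma$-equicontinuous. (b) If $(\mathcal F,\|\cdot\|,\tau_{co})$ is a sequentially complete Saks space, then $(C_{m,\varphi}(t))_{t\ge0}$ is a $\tau_{co}$-bi-continuous semigroup. (c) If $(\mathcal F,\|\cdot\|,\tau_{co})$ is a sequentially complete C-sequential Saks space, then $(C_{m,\varphi}(t))_{t\ge0}$ is quasi-$\gamma$-equicontinuous. (d) If $(\mathcal F,\|\cdot\|,\tau_{co})$ is a sequentially complete C-sequential Saks space and $\gamma=\gamma_s$ (for some $\Gamma$ as above), then $(C_{m,\varphi}(t))_{t\ge0}$ is quasi-$(\|\cdot\|,\tau_{co})$-equitight. -/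

import Mathlib

open Filter Topology
open scoped NNReal

noncomputable section

namespace Saks

section General

variable {𝕜 X : Type*} [RCLike 𝕜] [AddCommGroup X] [Module 𝕜 X]

/-- The (not necessarily Hausdorff) topology induced by a single seminorm. If `N` is a norm, this is
the norm topology. -/
def seminormTopology (p : Seminorm 𝕜 X) : TopologicalSpace X :=
  p.toSeminormedAddCommGroup.toUniformSpace.toTopologicalSpace

/-- The topology generated by a set of seminorms: the coarsest topology that is finer than the
topology of each of its members. (In Mathlib `t₁ ≤ t₂` means that `t₁` is finer than `t₂`.) -/
def generatedTopology (Γ : Set (Seminorm 𝕜 X)) : TopologicalSpace X :=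
  ⨅ p ∈ Γ, seminormTopology p

/-- A norm, given as a seminorm that vanishes only at `0`. -/
def IsNorm (N : Seminorm 𝕜 X) : Prop := ∀ x, N x = 0 → x = 0

/-- A set is bounded for `N`. -/
def NormBounded (N : Seminorm 𝕜 X) (B : Set X) : Prop := ∃ R : ℝ, ∀ x ∈ B, N x ≤ R

/-- A linear (vector space) topology on the `𝕜`-vector space `X`. -/
structure IsVectorTopology (𝕜 : Type*) {X : Type*} [RCLike 𝕜] [AddCommGroup X] [Module 𝕜 X]
    (τ : TopologicalSpace X) : Prop where
  addGroup : @IsTopologicalAddGroup X τ _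
  smul : @ContinuousSMul 𝕜 X _ _ τ

/-- The linear topologies that coincide with `τ` on norm-bounded sets and lie between `τ` and the
norm topology. -/
def mixedCandidates (N : Seminorm 𝕜 X) (τ : TopologicalSpace X) : Set (TopologicalSpace X) :=
  {t | IsVectorTopology 𝕜 t ∧ t ≤ τ ∧ seminormTopology N ≤ t ∧
    ∀ B : Set X, NormBounded N B →
      t.induced (Subtype.val : B → X) = τ.induced (Subtype.val : B → X)}

/-- The mixed topology `γ(N, τ)`: the finest linear topology that coincides with `τ` on
norm-bounded sets and lies between `τ` and the norm topology; see `isLeast_mixedTopology`. -/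
def mixedTopology (N : Seminorm 𝕜 X) (τ : TopologicalSpace X) : TopologicalSpace X :=
  sInf (mixedCandidates N τ)

/-- The mixed topology is itself one of the topologies of which it is the finest. -/
theorem isLeast_mixedTopology (N : Seminorm 𝕜 X) (τ : TopologicalSpace X)
    (hτ : IsVectorTopology 𝕜 τ) (h : seminormTopology N ≤ τ) :
    IsLeast (mixedCandidates N τ) (mixedTopology N τ) := by
  have hmem : τ ∈ mixedCandidates N τ := ⟨hτ, le_rfl, h, fun _ _ => rfl⟩
  refine ⟨⟨⟨?_, ?_⟩, sInf_le hmem, le_sInf fun t ht => ht.2.2.1, fun B hB => ?_⟩,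
    fun t ht => sInf_le ht⟩
  · exact topologicalAddGroup_sInf fun t ht => ht.1.addGroup
  · exact continuousSMul_sInf fun t ht => ht.1.smul
  · rw [mixedTopology, sInf_eq_iInf, induced_iInf]
    apply le_antisymm
    · refine (iInf_le _ τ).trans ?_
      rw [induced_iInf]
      exact iInf_le _ hmem
    · refine le_iInf fun t => ?_
      rw [induced_iInf]
      exact le_iInf fun ht => (ht.2.2.2 B hB).ge

/-- `(T i)` is `σ`-equicontinuous, in terms of the directed system of all `σ`-continuous seminorms.
Because of the constant `C`, any other directed generating system gives the same notion. -/
def Equicont (σ : TopologicalSpace X) {ι : Type*} (T : ι → X →ₗ[𝕜] X) : Prop :=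
  ∀ p : Seminorm 𝕜 X, @Continuous X ℝ σ _ p →
    ∃ q : Seminorm 𝕜 X, @Continuous X ℝ σ _ q ∧ ∃ C : ℝ, 0 ≤ C ∧
      ∀ i x, p (T i x) ≤ C * q x

/-- `(T i)` is `(N, τ)`-equitight, again in terms of all `τ`-continuous seminorms. -/
def Equitight (N : Seminorm 𝕜 X) (τ : TopologicalSpace X) {ι : Type*} (T : ι → X →ₗ[𝕜] X) : Prop :=
  ∀ ε : ℝ, 0 < ε → ∀ p : Seminorm 𝕜 X, @Continuous X ℝ τ _ p →
    ∃ q : Seminorm 𝕜 X, @Continuous X ℝ τ _ q ∧ ∃ C : ℝ, 0 ≤ C ∧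
      ∀ i x, p (T i x) ≤ C * q x + ε * N x

/-- `(T t)` is `σ`-strongly continuous. -/
structure StronglyCont (σ : TopologicalSpace X) (T : ℝ≥0 → X →ₗ[𝕜] X) : Prop where
  continuous_op : ∀ t, @Continuous X X σ σ (T t)
  continuous_orbit : ∀ x, @Continuous ℝ≥0 X _ σ (fun t => T t x)

/-- Local `σ`-equicontinuity: equicontinuity on every `[0, t₀]`. -/
def LocallyEquicont (σ : TopologicalSpace X) (T : ℝ≥0 → X →ₗ[𝕜] X) : Prop :=
  ∀ t₀ : ℝ≥0, Equicont σ (fun t : Set.Icc 0 t₀ => T t)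

/-- Quasi-`σ`-equicontinuity: `(e^{-ωt} T(t))` is `σ`-equicontinuous for some real `ω`. -/
def QuasiEquicont (σ : TopologicalSpace X) (T : ℝ≥0 → X →ₗ[𝕜] X) : Prop :=
  ∃ ω : ℝ, Equicont σ (fun t : ℝ≥0 => ((Real.exp (-ω * t) : ℝ) : 𝕜) • T t)

/-- Quasi-`(N, τ)`-equitightness: `(e^{-ωt} T(t))` is equitight for some real `ω`. -/
def QuasiEquitight (N : Seminorm 𝕜 X) (τ : TopologicalSpace X) (T : ℝ≥0 → X →ₗ[𝕜] X) : Prop :=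
  ∃ ω : ℝ, Equitight N τ (fun t : ℝ≥0 => ((Real.exp (-ω * t) : ℝ) : 𝕜) • T t)

/-- Local boundedness: the operator norms are bounded on every `[0, t₀]`. -/
def LocallyBounded (N : Seminorm 𝕜 X) (T : ℝ≥0 → X →ₗ[𝕜] X) : Prop :=
  ∀ t₀ : ℝ≥0, ∃ C : ℝ, ∀ t ≤ t₀, ∀ x, N (T t x) ≤ C * N x

/-- `T` is a `τ`-bi-continuous semigroup: an exponentially bounded, strongly `τ`-continuous and
locally bi-equicontinuous semigroup of linear operators. -/
structure IsBiContinuous (N : Seminorm 𝕜 X) (τ : TopologicalSpace X) (T : ℝ≥0 → X →ₗ[𝕜] X) :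
    Prop where
  zero : T 0 = LinearMap.id
  add : ∀ t s, T (t + s) = T t ∘ₗ T s
  exp_bounded : ∃ M ω : ℝ, 1 ≤ M ∧ ∀ (t : ℝ≥0) (x : X), N (T t x) ≤ M * Real.exp (ω * t) * N x
  continuous_orbit : ∀ x, @Continuous ℝ≥0 X _ τ (fun t => T t x)
  /-- If a norm-bounded sequence `u` converges to `x` for `τ`, then `T t (u n) - T t x` tends to
  `0` for `τ`, uniformly for `t ∈ [0, t₀]`. -/
  biEquicont : ∀ (t₀ : ℝ≥0) (u : ℕ → X) (x : X), NormBounded N (Set.range u) →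
    Tendsto u atTop (@nhds X τ x) →
      ∀ U ∈ @nhds X τ 0, ∀ᶠ n in atTop, ∀ t ≤ t₀, T t (u n) - T t x ∈ U

/-- Every Cauchy sequence of `(X, σ)` converges. -/
def SeqComplete (σ : TopologicalSpace X) : Prop :=
  ∀ u : ℕ → X, (∀ U ∈ @nhds X σ 0, ∃ n₀, ∀ m ≥ n₀, ∀ n ≥ n₀, u m - u n ∈ U) →
    ∃ x, Tendsto u atTop (@nhds X σ x)

/-- `(X, σ)` is C-sequential: every convex sequentially open set is open. -/
def CSequential [Module ℝ X] (σ : TopologicalSpace X) : Prop :=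
  ∀ U : Set X, Convex ℝ U →
    (∀ x ∈ U, ∀ u : ℕ → X, Tendsto u atTop (@nhds X σ x) → ∀ᶠ n in atTop, u n ∈ U) →
      @IsOpen X σ U

/-- `(X, N, τ)` is a pre-Saks space: `N` is a norm and `τ` is a Hausdorff locally convex topology
that is coarser than the norm topology. -/
structure IsPreSaks [Module ℝ X] (N : Seminorm 𝕜 X) (τ : TopologicalSpace X) : Prop where
  norm : IsNorm N
  linear : IsVectorTopology 𝕜 τ
  locallyConvex : @LocallyConvexSpace ℝ X _ _ _ _ τ
  t2 : @T2Space X τ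
  le : seminormTopology N ≤ τ

/-- `Γ` is a directed system of seminorms that generates `τ` and whose pointwise supremum is the
norm `N`. -/
structure IsSaksSystem (N : Seminorm 𝕜 X) (τ : TopologicalSpace X) (Γ : Set (Seminorm 𝕜 X)) :
    Prop where
  nonempty : Γ.Nonempty
  directed : ∀ p ∈ Γ, ∀ q ∈ Γ, ∃ r ∈ Γ, ∃ C : ℝ, 0 ≤ C ∧ ∀ x, max (p x) (q x) ≤ C * r x
  generates : τ = generatedTopology Γ
  isLUB : ∀ x, IsLUB ((fun p : Seminorm 𝕜 X => p x) '' Γ) (N x)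

/-- `(X, N, τ)` is a Saks space. -/
def IsSaks [Module ℝ X] (N : Seminorm 𝕜 X) (τ : TopologicalSpace X) : Prop :=
  IsPreSaks N τ ∧ ∃ Γ : Set (Seminorm 𝕜 X), IsSaksSystem N τ Γ

/-- The seminorm `x ↦ sup_n a_n p_n(x)`; see `submixedSeminorm_apply`. -/
def submixedSeminorm (p : ℕ → Seminorm 𝕜 X) (a : ℕ → ℝ≥0) : Seminorm 𝕜 X := ⨆ n, a n • p n

/-- For seminorms dominated by `N` and a null sequence `a`, the supremum is the pointwise one and
it is finite. -/
theorem submixedSeminorm_apply (N : Seminorm 𝕜 X) {p : ℕ → Seminorm 𝕜 X} {a : ℕ → ℝ≥0}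
    (hp : ∀ n x, p n x ≤ N x) (ha : Tendsto a atTop (𝓝 0)) (x : X) :
    IsLUB (Set.range fun n => p n x * a n) (submixedSeminorm p a x) := by
  obtain ⟨c, hc⟩ := ha.bddAbove_range
  have hc' : ∀ n, a n ≤ c := fun n => hc ⟨n, rfl⟩
  have hle : ∀ n y, (a n • p n) y ≤ c * N y := fun n y =>
    mul_le_mul (by exact_mod_cast hc' n) (hp n y) (apply_nonneg _ _) c.2
  have hb : BddAbove (Set.range fun n => a n • p n) := by
    refine ⟨c • N, ?_⟩
    rintro _ ⟨n, rfl⟩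
    exact fun y => hle n y
  have hx : BddAbove (Set.range fun n => (a n • p n) x) := by
    refine ⟨c * N x, ?_⟩
    rintro _ ⟨n, rfl⟩
    exact hle n x
  have h := isLUB_ciSup hx
  rw [submixedSeminorm, Seminorm.iSup_apply hb]
  have e : (fun n => p n x * (a n : ℝ)) = fun n => (a n • p n) x := by
    funext n
    exact mul_comm _ _
  rw [e]
  exact h

/-- The submixed topology `γ_s` formed with `Γ`: it is generated by the seminorms
`x ↦ sup_n a_n p_n(x)`, where `p_n ∈ Γ` and `(a_n)` is a nonnegative null sequence. -/
def submixedTopology (Γ : Set (Seminorm 𝕜 X)) : TopologicalSpace X :=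
  generatedTopology {r | ∃ (p : ℕ → Seminorm 𝕜 X) (a : ℕ → ℝ≥0),
    (∀ n, p n ∈ Γ) ∧ Tendsto a atTop (𝓝 0) ∧ r = submixedSeminorm p a}

end General

section Functions

variable {𝕜 Ω : Type*} [RCLike 𝕜] [TopologicalSpace Ω]

/-- The relative compact-open topology on a space of continuous functions. -/
def coTopology (F : Submodule 𝕜 C(Ω, 𝕜)) : TopologicalSpace F :=
  ContinuousMap.compactOpen.induced (Subtype.val : F → C(Ω, 𝕜))

/-- `φ` is a semiflow. -/
structure IsSemiflow (φ : ℝ≥0 → C(Ω, Ω)) : Prop where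
  zero : ∀ x, φ 0 x = x
  add : ∀ t s x, φ (t + s) x = φ t (φ s x)

/-- `m` is a multiplicative semicocycle for `φ`. -/
structure IsSemicocycle (φ : ℝ≥0 → C(Ω, Ω)) (m : ℝ≥0 → C(Ω, 𝕜)) : Prop where
  zero : ∀ x, m 0 x = 1
  add : ∀ t s x, m (t + s) x = m t x * m s (φ t x)

/-- `(m, φ)` is a co-semiflow. -/
structure IsCoSemiflow (m : ℝ≥0 → C(Ω, 𝕜)) (φ : ℝ≥0 → C(Ω, Ω)) : Prop where
  semiflow : IsSemiflow φ
  semicocycle : IsSemicocycle φ m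

/-- Joint continuity of a family of continuous maps. -/
def JointlyContinuous {Y : Type*} [TopologicalSpace Y] (φ : ℝ≥0 → C(Ω, Y)) : Prop :=
  Continuous fun z : ℝ≥0 × Ω => φ z.1 z.2

/-- The weighted composition operator `f ↦ m · (f ∘ φ)`. -/
def weightedComp (m : C(Ω, 𝕜)) (φ : C(Ω, Ω)) : C(Ω, 𝕜) →ₗ[𝕜] C(Ω, 𝕜) where
  toFun f := m * f.comp φ
  map_add' f g := by ext x; simp [mul_add]
  map_smul' c f := by ext x; simp

/-- The weighted composition family `C_{m,φ}(t)` on `F`, which `C_{m,φ}(t)` maps into itself. -/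
def weightedSemigroup (F : Submodule 𝕜 C(Ω, 𝕜)) (m : ℝ≥0 → C(Ω, 𝕜)) (φ : ℝ≥0 → C(Ω, Ω))
    (hF : ∀ t, ∀ f ∈ F, weightedComp (m t) (φ t) f ∈ F) (t : ℝ≥0) : F →ₗ[𝕜] F :=
  (weightedComp (m t) (φ t)).restrict (hF t)

end Functions

end Saks

end

/-!
The operators `C_{m,φ}(t)`, `t ∈ [0, t₀]`, are equicontinuous for the compact-open topology `τ`: by
joint continuity, the values of `C_{m,φ}(t) f` on a compact set `K` are controlled by those of `f`
on the compact set `φ([0, t₀] × K)`, because `m` is bounded on `[0, t₀] × K`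
(`equicontAtZero_weightedSemigroup`). Joint continuity also makes the orbits `τ`-continuous. The
rest of the argument is about a locally bounded, locally `τ`-equicontinuous semigroup on a space
with a norm and a coarser linear topology `τ`.

To pass to the mixed topology `γ`, one uses that it is the finest among certain linear topologies.
Hence any linear topology that is coarser than the norm topology, and coarser than `τ` on
norm-bounded sets, is coarser than `γ` (`mixedTopology_le`). Applied to the topology of one seminorm
`q`, this says that `q` is `γ`-continuous once it is `τ`-continuous at `0` on each ball of the norm
(`continuous_mixedTopology_of_ball`). Given a `γ`-continuous seminorm `p`, the seminorm
`q = sup_i p ∘ T_i` has this property if `(T_i)` is uniformly norm bounded and `τ`-equicontinuous at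
`0` on balls, since `γ` and `τ` agree there; so `(T_i)` is `γ`-equicontinuous
(`equicont_mixedTopology`).

For the global statements, a locally bounded semigroup is exponentially bounded, so that
`e^{-ωt} T(t)` decays exponentially in norm for some `ω` (`exists_rescaling`). Large times are then
negligible on a ball of the norm, because `τ` is coarser than the norm topology, and small times are
dealt with by local `τ`-equicontinuity. This gives `τ`-equicontinuity at `0` on balls
(`equicont_on_ball_of_exp_decay`), hence quasi-`γ`-equicontinuity, and also equitightness
(`equitight_of_exp_decay`).
-/

namespace Saks

section Abstract

variable {𝕜 X : Type*} [RCLike 𝕜] [AddCommGroup X] [Module 𝕜 X]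

/-! ### Linear topologies and seminorms -/

theorem isVectorTopology_seminormTopology (p : Seminorm 𝕜 X) :
    IsVectorTopology 𝕜 (seminormTopology p) := by
  let := p.toSeminormedAddCommGroup
  let : NormedSpace 𝕜 X := { norm_smul_le := fun a b => (map_smul_eq_mul p a b).le }
  exact ⟨inferInstanceAs (IsTopologicalAddGroup X), inferInstanceAs (ContinuousSMul 𝕜 X)⟩

theorem IsVectorTopology.induced {Y : Type*} [AddCommGroup Y] [Module 𝕜 Y]
    {τ : TopologicalSpace Y} (h : IsVectorTopology 𝕜 τ) (T : X →ₗ[𝕜] Y) :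
    IsVectorTopology 𝕜 (τ.induced T) := by
  let := τ
  have := h.addGroup
  have := h.smul
  exact ⟨topologicalAddGroup_induced T, continuousSMul_induced T⟩

theorem IsVectorTopology.inf {s t : TopologicalSpace X} (hs : IsVectorTopology 𝕜 s)
    (ht : IsVectorTopology 𝕜 t) : IsVectorTopology 𝕜 (s ⊓ t) :=
  ⟨topologicalAddGroup_inf hs.addGroup ht.addGroup, @continuousSMul_inf _ _ _ _ s t hs.smul ht.smul⟩

theorem nhds_seminormTopology_basis (p : Seminorm 𝕜 X) (x : X) :
    (@nhds X (seminormTopology p) x).HasBasis (fun ε : ℝ => 0 < ε) fun ε => {y | p (y - x) < ε} := by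
  let := p.toSeminormedAddCommGroup
  have h : (𝓝 x).HasBasis (fun ε : ℝ => 0 < ε) fun ε => {y | p (y - x) < ε} := by
    convert Metric.nhds_basis_ball (x := x) using 2 with ε
    ext y
    rw [Metric.mem_ball, dist_eq_norm]
    rfl
  exact h

theorem mem_nhds_seminormTopology_zero {p : Seminorm 𝕜 X} {U : Set X} :
    U ∈ @nhds X (seminormTopology p) 0 ↔ ∃ ε > 0, ∀ x, p x < ε → x ∈ U := by
  simp [(nhds_seminormTopology_basis p 0).mem_iff, Set.subset_def]

theorem continuous_seminorm_of_mem_nhds {τ : TopologicalSpace X} (hτ : IsVectorTopology 𝕜 τ)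
    {p : Seminorm 𝕜 X} (h : {x | p x ≤ 1} ∈ @nhds X τ 0) : @Continuous X ℝ τ _ p := by
  let := τ
  have := hτ.addGroup
  have := hτ.smul
  refine Seminorm.continuous' (𝕜 := 𝕜) (r := 1) ?_
  rwa [p.closedBall_zero_eq]

theorem continuous_seminormTopology_self (p : Seminorm 𝕜 X) :
    @Continuous X ℝ (seminormTopology p) _ p :=
  continuous_seminorm_of_mem_nhds (isVectorTopology_seminormTopology p)
    (mem_nhds_seminormTopology_zero.2 ⟨1, one_pos, fun _ => le_of_lt⟩)

theorem setOf_seminorm_lt_mem_nhds {τ : TopologicalSpace X} {p : Seminorm 𝕜 X}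
    (hp : @Continuous X ℝ τ _ p) {ε : ℝ} (hε : 0 < ε) : {x | p x < ε} ∈ @nhds X τ 0 := by
  let := τ
  exact hp.continuousAt.eventually_lt continuousAt_const (by simpa using hε)

/-- A seminorm continuous for a topology coarser than the norm topology is dominated by a multiple
of the norm. -/
theorem exists_le_mul_of_continuous {N p : Seminorm 𝕜 X} {τ : TopologicalSpace X}
    (hN : seminormTopology N ≤ τ) (hp : @Continuous X ℝ τ _ p) :
    ∃ C : ℝ, 0 < C ∧ ∀ x, p x ≤ C * N x := by
  have hp' := continuous_le_dom hN hp
  let := N.toSeminormedAddCommGroup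
  let : NormedSpace 𝕜 X := { norm_smul_le := fun a b => (map_smul_eq_mul N a b).le }
  exact Seminorm.bound_of_continuous_normedSpace (p : Seminorm 𝕜 X) hp'

/-! ### Continuity for the mixed topology -/

/-- A linear topology coarser than the norm topology, and on norm-bounded sets coarser than `τ`,
is coarser than the mixed topology: its infimum with `τ` is one of the topologies of which the
mixed topology is the finest. -/
theorem mixedTopology_le {N : Seminorm 𝕜 X} {τ t : TopologicalSpace X}
    (hτ : IsVectorTopology 𝕜 τ) (hN : seminormTopology N ≤ τ) (ht : IsVectorTopology 𝕜 t)
    (hNt : seminormTopology N ≤ t)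
    (h : ∀ B : Set X, NormBounded N B →
      τ.induced (Subtype.val : B → X) ≤ t.induced (Subtype.val : B → X)) :
    mixedTopology N τ ≤ t := by
  have hmem : t ⊓ τ ∈ mixedCandidates N τ :=
    ⟨ht.inf hτ, inf_le_right, le_inf hNt hN, fun B hB => by
      rw [induced_inf]
      exact inf_eq_right.2 (h B hB)⟩
  exact (sInf_le hmem).trans inf_le_left

/-- A seminorm is continuous for the mixed topology as soon as its restriction to each ball of
the norm is `τ`-continuous at `0`. -/
theorem continuous_mixedTopology_of_ball {N : Seminorm 𝕜 X} {τ : TopologicalSpace X}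
    (hτ : IsVectorTopology 𝕜 τ) (hN : seminormTopology N ≤ τ) {q : Seminorm 𝕜 X}
    (h : ∀ R ε : ℝ, 0 < ε → ∃ V ∈ @nhds X τ 0, ∀ x ∈ V, N x ≤ R → q x ≤ ε) :
    @Continuous X ℝ (mixedTopology N τ) _ q := by
  refine continuous_le_dom (mixedTopology_le hτ hN (isVectorTopology_seminormTopology q) ?_ ?_)
    (continuous_seminormTopology_self q)
  · refine (@le_of_nhds_le_nhds X (seminormTopology N) (seminormTopology q) fun x => ?_)
    refine (nhds_seminormTopology_basis q x).ge_iff.2 fun ε hε => ?_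
    obtain ⟨V, hV, hVq⟩ := h 1 (ε / 2) (half_pos hε)
    obtain ⟨δ, hδ, hδV⟩ := mem_nhds_seminormTopology_zero.1 (nhds_mono hN hV)
    refine (nhds_seminormTopology_basis N x).mem_iff.2 ⟨min δ 1, by positivity, fun y hy => ?_⟩
    exact (hVq _ (hδV _ (lt_of_lt_of_le hy (min_le_left _ _)))
      (le_of_lt (lt_of_lt_of_le hy (min_le_right _ _)))).trans_lt (half_lt_self hε)
  · rintro B ⟨R, hR⟩
    -- Differences of points of `B` lie in the ball of radius `R + R`.
    refine @le_of_nhds_le_nhds B _ _ fun x => ?_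
    rw [@nhds_induced _ _ τ, @nhds_induced _ _ (seminormTopology q)]
    refine ((nhds_seminormTopology_basis q x).comap _).ge_iff.2 fun ε hε => ?_
    obtain ⟨V, hV, hVq⟩ := h (R + R) (ε / 2) (half_pos hε)
    let := τ
    have := hτ.addGroup
    have hsub : Tendsto (fun y : X => y - x) (𝓝 (x : X)) (𝓝 0) := by
      simpa using (tendsto_id (x := 𝓝 (x : X))).sub_const (x : X)
    refine ⟨_, hsub hV, fun y hy => ?_⟩
    exact (hVq _ hy ((map_sub_le_add N _ _).trans (add_le_add (hR _ y.2) (hR _ x.2)))).trans_lt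
      (half_lt_self hε)

/-- A `τ`-continuous norm-bounded operator is continuous for the mixed topology. -/
theorem continuous_mixedTopology_of_bounded {N : Seminorm 𝕜 X} {τ : TopologicalSpace X}
    (hτ : IsVectorTopology 𝕜 τ) (hN : seminormTopology N ≤ τ) {T : X →ₗ[𝕜] X}
    (hT : @Continuous X X τ τ T) {C : ℝ} (hC : ∀ x, N (T x) ≤ C * N x) :
    @Continuous X X (mixedTopology N τ) (mixedTopology N τ) T := by
  have hγ := (isLeast_mixedTopology N τ hτ hN).1
  rw [continuous_iff_le_induced]
  refine mixedTopology_le hτ hN (hγ.1.induced T) ?_ ?_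
  · refine le_trans ?_ (induced_mono hγ.2.2.1)
    refine (@le_of_nhds_le_nhds X _ _ fun x => ?_)
    rw [@nhds_induced _ _ (seminormTopology N)]
    refine ((nhds_seminormTopology_basis N (T x)).comap _).ge_iff.2 fun ε hε => ?_
    refine (nhds_seminormTopology_basis N x).mem_iff.2
      ⟨ε / (|C| + 1), by positivity, fun y hy => ?_⟩
    have hy' : N (y - x) * (|C| + 1) < ε := (lt_div_iff₀ (by positivity)).1 hy
    have h1 := hC (y - x)
    have h2 := mul_le_mul_of_nonneg_right (le_abs_self C) (apply_nonneg N (y - x))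
    have h3 := apply_nonneg N (y - x)
    rw [map_sub] at h1
    show N (T y - T x) < ε
    linarith
  · rintro B ⟨R, hR⟩
    -- `T` maps `B` to a norm-bounded set, on which the mixed topology is `τ`.
    have hB : NormBounded N (T '' B) := by
      refine ⟨|C| * R, ?_⟩
      rintro _ ⟨x, hx, rfl⟩
      exact (hC x).trans ((mul_le_mul_of_nonneg_right (le_abs_self C) (apply_nonneg N x)).trans
        (mul_le_mul_of_nonneg_left (hR x hx) (abs_nonneg C)))
    let S : B → T '' B := fun x => ⟨T x, x, x.2, rfl⟩
    have e : ∀ t : TopologicalSpace X,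
        (t.induced T).induced (Subtype.val : B → X) =
          (t.induced (Subtype.val : T '' B → X)).induced S := fun t => by
      rw [induced_compose, induced_compose]
      rfl
    rw [e, hγ.2.2.2 _ hB, ← e]
    exact induced_mono (continuous_iff_le_induced.1 hT)

/-- A map with norm-bounded range that is `τ`-continuous is continuous for the mixed topology. -/
theorem continuous_mixedTopology_of_normBounded_range {N : Seminorm 𝕜 X} {τ : TopologicalSpace X}
    (hτ : IsVectorTopology 𝕜 τ) (hN : seminormTopology N ≤ τ) {Y : Type*} [TopologicalSpace Y]
    {f : Y → X} (hf : @Continuous Y X _ τ f) (hb : NormBounded N (Set.range f)) :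
    @Continuous Y X _ (mixedTopology N τ) f := by
  have hγ := (isLeast_mixedTopology N τ hτ hN).1
  rw [continuous_iff_le_induced] at hf ⊢
  have e : ∀ t : TopologicalSpace X, t.induced f =
      (t.induced (Subtype.val : Set.range f → X)).induced (Set.rangeFactorization f) := fun t => by
    rw [induced_compose]
    rfl
  rw [e, hγ.2.2.2 _ hb, ← e]
  exact hf

/-! ### Equicontinuous families of operators -/

/-- The pointwise supremum of the seminorms `p ∘ T i`, if it is finite. The index type may be empty,
whence the condition `0 ≤ c`. -/
theorem exists_seminorm_sup {ι : Type*} (p : Seminorm 𝕜 X) (T : ι → X →ₗ[𝕜] X)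
    (h : ∀ x, BddAbove (Set.range fun i => p (T i x))) :
    ∃ q : Seminorm 𝕜 X, (∀ i x, p (T i x) ≤ q x) ∧
      ∀ x c, 0 ≤ c → (∀ i, p (T i x) ≤ c) → q x ≤ c := by
  have hb : BddAbove (Set.range fun i => p.comp (T i)) := Seminorm.bddAbove_range_iff.2 h
  refine ⟨⨆ i, p.comp (T i), fun i x => ?_, fun x c hc hi => ?_⟩
  · rw [Seminorm.iSup_apply hb]
    exact le_ciSup (h x) i
  · rw [Seminorm.iSup_apply hb]
    exact Real.iSup_le hi hc

/-- Equicontinuity of a family of operators in terms of neighbourhoods of `0`. Unlike `Equicont`, it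
does not depend on the supply of continuous seminorms. -/
def EquicontAtZero (σ : TopologicalSpace X) {ι : Type*} (T : ι → X →ₗ[𝕜] X) : Prop :=
  ∀ U ∈ @nhds X σ 0, ∃ V ∈ @nhds X σ 0, ∀ i, ∀ x ∈ V, T i x ∈ U

theorem EquicontAtZero.continuous {σ : TopologicalSpace X} (hσ : IsVectorTopology 𝕜 σ) {ι : Type*}
    {T : ι → X →ₗ[𝕜] X} (h : EquicontAtZero σ T) (i : ι) : @Continuous X X σ σ (T i) := by
  let := σ
  have := hσ.addGroup
  refine continuous_of_continuousAt_zero (T i) fun U hU => ?_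
  rw [map_zero] at hU
  obtain ⟨V, hV, hVU⟩ := h U hU
  exact mem_map.2 (mem_of_superset hV (hVU i))

theorem EquicontAtZero.smul {σ : TopologicalSpace X} (hσ : IsVectorTopology 𝕜 σ) {ι : Type*}
    {T : ι → X →ₗ[𝕜] X} (h : EquicontAtZero σ T) {c : ι → 𝕜} (hc : ∀ i, ‖c i‖ ≤ 1) :
    EquicontAtZero σ fun i => c i • T i := by
  let := σ
  have := hσ.smul
  intro U hU
  obtain ⟨W, ⟨hW, hWb⟩, hWU⟩ := (nhds_basis_balanced 𝕜 X).mem_iff.1 hU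
  obtain ⟨V, hV, hVW⟩ := h W hW
  exact ⟨V, hV, fun i x hx => hWU (hWb.smul_mem (hc i) (hVW i x hx))⟩

/-- For a continuous seminorm `p`, the seminorm `sup_i p ∘ T i` is finite, as neighbourhoods of `0`
are absorbent, and it is at most `1` on a neighbourhood of `0`. -/
theorem EquicontAtZero.equicont {σ : TopologicalSpace X} (hσ : IsVectorTopology 𝕜 σ) {ι : Type*}
    {T : ι → X →ₗ[𝕜] X} (h : EquicontAtZero σ T) : Equicont σ T := by
  intro p hp
  obtain ⟨V, hV, hVU⟩ := h _ (setOf_seminorm_lt_mem_nhds hp one_pos)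
  have hb : BddAbove (Set.range fun i => p.comp (T i)) := by
    let := σ
    have := hσ.smul
    refine Seminorm.bddAbove_of_absorbent (absorbent_nhds_zero (𝕜 := 𝕜) hV) fun x hx => ⟨1, ?_⟩
    rintro _ ⟨i, rfl⟩
    exact (hVU i x hx).le
  obtain ⟨q, hq, hq'⟩ := exists_seminorm_sup p T (Seminorm.bddAbove_range_iff.1 hb)
  refine ⟨q, continuous_seminorm_of_mem_nhds hσ ?_, 1, zero_le_one, fun i x => ?_⟩
  · exact mem_of_superset hV fun x hx => hq' x 1 zero_le_one fun i => (hVU i x hx).le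
  · simpa using hq i x

/-- A uniformly norm-bounded family that is `τ`-equicontinuous at `0` on each ball of the norm is
equicontinuous for the mixed topology. -/
theorem equicont_mixedTopology {N : Seminorm 𝕜 X} {τ : TopologicalSpace X}
    (hτ : IsVectorTopology 𝕜 τ) (hN : seminormTopology N ≤ τ) {ι : Type*} {T : ι → X →ₗ[𝕜] X}
    {C : ℝ} (hC0 : 0 ≤ C) (hC : ∀ i x, N (T i x) ≤ C * N x)
    (hT : ∀ R : ℝ, ∀ U ∈ @nhds X τ 0, ∃ V ∈ @nhds X τ 0, ∀ i, ∀ x ∈ V, N x ≤ R → T i x ∈ U) :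
    Equicont (mixedTopology N τ) T := by
  have hγ := (isLeast_mixedTopology N τ hτ hN).1
  intro p hp
  obtain ⟨D, hD, hpD⟩ := exists_le_mul_of_continuous hγ.2.2.1 hp
  have hb : ∀ x, BddAbove (Set.range fun i => p (T i x)) := fun x => by
    refine ⟨D * (C * N x), ?_⟩
    rintro _ ⟨i, rfl⟩
    exact (hpD _).trans (mul_le_mul_of_nonneg_left (hC i x) hD.le)
  obtain ⟨q, hq, hq'⟩ := exists_seminorm_sup p T hb
  refine ⟨q, continuous_mixedTopology_of_ball hτ hN fun R ε hε => ?_, 1, zero_le_one,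
    fun i x => by simpa using hq i x⟩
  -- The `p`-ball of radius `ε` is, within the norm ball of radius `C * |R|`, a `τ`-neighbourhood.
  let B : Set X := {x | N x ≤ C * |R|}
  have h0 : (0 : X) ∈ B := by
    show N 0 ≤ C * |R|
    rw [map_zero]
    positivity
  have hU : {x : B | p x < ε} ∈ (@nhds X τ 0).comap (Subtype.val : B → X) := by
    have e : (@nhds X τ 0).comap (Subtype.val : B → X) =
        (@nhds X (mixedTopology N τ) 0).comap (Subtype.val : B → X) := by
      have := hγ.2.2.2 B ⟨_, fun x hx => hx⟩
      have h1 := @nhds_induced _ _ τ (Subtype.val : B → X) ⟨0, h0⟩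
      have h2 := @nhds_induced _ _ (mixedTopology N τ) (Subtype.val : B → X) ⟨0, h0⟩
      rw [← h1, ← h2, this]
    rw [e]
    exact ⟨_, setOf_seminorm_lt_mem_nhds hp hε, fun x hx => hx⟩
  obtain ⟨U, hU, hUp⟩ := hU
  obtain ⟨V, hV, hVU⟩ := hT R U hU
  refine ⟨V, hV, fun x hx hxR => hq' x ε hε.le fun i => ?_⟩
  have hB : T i x ∈ B := (hC i x).trans (mul_le_mul_of_nonneg_left (hxR.trans (le_abs_self R)) hC0)
  have : (⟨T i x, hB⟩ : B) ∈ {x : B | p x < ε} := hUp (hVU i x hx hxR)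
  exact le_of_lt this

/-! ### Locally bounded semigroups -/

theorem exists_exp_decay_lt (a : ℝ) {ε : ℝ} (hε : 0 < ε) :
    ∃ t₀ : ℝ≥0, ∀ t ≥ t₀, a * Real.exp (-(t : ℝ)) < ε := by
  have h : Tendsto (fun t : ℝ≥0 => a * Real.exp (-(t : ℝ))) atTop (𝓝 0) := by
    simpa using (Real.tendsto_exp_neg_atTop_nhds_zero.comp
      (NNReal.tendsto_coe_atTop.2 tendsto_id)).const_mul a
  exact eventually_atTop.1 (h.eventually (gt_mem_nhds hε))

section Semigroup

variable {N : Seminorm 𝕜 X} {τ : TopologicalSpace X} {T : ℝ≥0 → X →ₗ[𝕜] X}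

/-- A locally bounded semigroup is exponentially bounded. -/
theorem LocallyBounded.exp_bounded (hb : LocallyBounded N T)
    (hadd : ∀ t s, T (t + s) = T t ∘ₗ T s) :
    ∃ M ω : ℝ, 1 ≤ M ∧ 0 ≤ ω ∧ ∀ (t : ℝ≥0) (x : X), N (T t x) ≤ M * Real.exp (ω * t) * N x := by
  obtain ⟨C, hC⟩ := hb 1
  set M := max C 1
  have hM1 : 1 ≤ M := le_max_right _ _
  have hM0 : 0 < M := one_pos.trans_le hM1
  have h1 : ∀ t ≤ (1 : ℝ≥0), ∀ x, N (T t x) ≤ M * N x := fun t ht x =>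
    (hC t ht x).trans (mul_le_mul_of_nonneg_right (le_max_left _ _) (apply_nonneg N x))
  have h2 : ∀ (n : ℕ) (s : ℝ≥0), s ≤ 1 → ∀ x, N (T (n + s) x) ≤ M ^ n * (M * N x) := by
    intro n s hs x
    induction n with
    | zero => simpa using h1 s hs x
    | succ n ih =>
      have e : ((n + 1 : ℕ) : ℝ≥0) + s = 1 + (n + s) := by push_cast; ring
      rw [e, hadd, LinearMap.comp_apply, pow_succ', mul_assoc]
      exact (h1 1 le_rfl _).trans (mul_le_mul_of_nonneg_left ih hM0.le)
  refine ⟨M, Real.log M, hM1, Real.log_nonneg hM1, fun t x => ?_⟩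
  have hfl : (⌊t⌋₊ : ℝ≥0) ≤ t := Nat.floor_le (zero_le)
  have hlt : t - ⌊t⌋₊ ≤ 1 := by
    rw [tsub_le_iff_left]
    exact (Nat.lt_floor_add_one t).le
  have h3 := h2 ⌊t⌋₊ (t - ⌊t⌋₊) hlt x
  rw [add_tsub_cancel_of_le hfl] at h3
  have h4 : M ^ ⌊t⌋₊ ≤ Real.exp (Real.log M * t) := by
    rw [← Real.rpow_natCast, Real.rpow_def_of_pos hM0]
    exact Real.exp_le_exp.2 (mul_le_mul_of_nonneg_left (by exact_mod_cast hfl)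
      (Real.log_nonneg hM1))
  calc N (T t x) ≤ M ^ ⌊t⌋₊ * (M * N x) := h3
    _ ≤ Real.exp (Real.log M * t) * (M * N x) := by
      have := apply_nonneg N x
      gcongr
    _ = M * Real.exp (Real.log M * t) * N x := by ring

/-- An equicontinuous family on each `[0, t₀]` whose norm decays exponentially is `τ`-equicontinuous
at `0` on each ball of the norm: small times are dealt with by local equicontinuity, and at large
times the image of the ball lies in any given norm neighbourhood of `0`. -/
theorem equicont_on_ball_of_exp_decay (hN : seminormTopology N ≤ τ)
    (hT : ∀ t₀ : ℝ≥0, EquicontAtZero τ fun t : Set.Icc 0 t₀ => T t) {M : ℝ}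
    (hM : ∀ (t : ℝ≥0) x, N (T t x) ≤ M * Real.exp (-t) * N x) (R : ℝ) {U : Set X}
    (hU : U ∈ @nhds X τ 0) :
    ∃ V ∈ @nhds X τ 0, ∀ t, ∀ x ∈ V, N x ≤ R → T t x ∈ U := by
  obtain ⟨δ, hδ, hδU⟩ := mem_nhds_seminormTopology_zero.1 (nhds_mono hN hU)
  obtain ⟨t₀, ht₀⟩ := exists_exp_decay_lt (|M| * |R|) hδ
  obtain ⟨V, hV, hVU⟩ := hT t₀ U hU
  refine ⟨V, hV, fun t x hx hxR => ?_⟩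
  rcases le_total t t₀ with h | h
  · exact hVU ⟨t, zero_le, h⟩ x hx
  · refine hδU _ ((hM t x).trans_lt (lt_of_le_of_lt ?_ (ht₀ t h)))
    calc M * Real.exp (-t) * N x ≤ |M| * Real.exp (-t) * |R| := by
          have := apply_nonneg N x
          gcongr
          exacts [le_abs_self M, hxR.trans (le_abs_self R)]
      _ = |M| * |R| * Real.exp (-t) := by ring

/-- An equicontinuous family on each `[0, t₀]` whose norm decays exponentially is equitight: a
`τ`-continuous seminorm is dominated by a multiple of the norm, which takes care of large times. -/
theorem equitight_of_exp_decay (hτ : IsVectorTopology 𝕜 τ) (hN : seminormTopology N ≤ τ)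
    (hT : ∀ t₀ : ℝ≥0, EquicontAtZero τ fun t : Set.Icc 0 t₀ => T t) {M : ℝ}
    (hM : ∀ (t : ℝ≥0) x, N (T t x) ≤ M * Real.exp (-t) * N x) : Equitight N τ T := by
  intro ε hε p hp
  obtain ⟨D, hD, hpD⟩ := exists_le_mul_of_continuous hN hp
  obtain ⟨t₀, ht₀⟩ := exists_exp_decay_lt (D * M) hε
  obtain ⟨q, hq, C, hC, hqC⟩ := (hT t₀).equicont hτ p hp
  refine ⟨q, hq, C, hC, fun t x => ?_⟩
  have hx := apply_nonneg N x
  rcases le_total t t₀ with h | h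
  · exact (hqC ⟨t, zero_le, h⟩ x).trans (le_add_of_nonneg_right (by positivity))
  · calc p (T t x) ≤ D * (M * Real.exp (-t) * N x) :=
          (hpD _).trans (mul_le_mul_of_nonneg_left (hM t x) hD.le)
      _ = D * M * Real.exp (-t) * N x := by ring
      _ ≤ ε * N x := mul_le_mul_of_nonneg_right (ht₀ t h).le hx
      _ ≤ C * q x + ε * N x := le_add_of_nonneg_left (mul_nonneg hC (apply_nonneg q x))

theorem stronglyCont_mixedTopology (hτ : IsVectorTopology 𝕜 τ) (hN : seminormTopology N ≤ τ)
    (hT : ∀ t₀ : ℝ≥0, EquicontAtZero τ fun t : Set.Icc 0 t₀ => T t) (hb : LocallyBounded N T)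
    (horb : ∀ x, @Continuous ℝ≥0 X _ τ fun t => T t x) :
    StronglyCont (mixedTopology N τ) T := by
  refine ⟨fun t => ?_, fun x => ?_⟩
  · obtain ⟨C, hC⟩ := hb t
    exact continuous_mixedTopology_of_bounded hτ hN ((hT t).continuous hτ ⟨t, zero_le, le_rfl⟩)
      (hC t le_rfl)
  · let := mixedTopology N τ
    -- The orbit is norm bounded on `[0, t + 1)`, which is a neighbourhood of `t`.
    refine continuous_iff_continuousAt.2 fun t => ?_
    obtain ⟨C, hC⟩ := hb (t + 1)
    have ht : t < t + 1 := lt_add_of_pos_right t one_pos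
    refine ContinuousOn.continuousAt (s := Set.Iio (t + 1)) ?_ (Iio_mem_nhds ht)
    rw [continuousOn_iff_continuous_domRestrict]
    refine continuous_mixedTopology_of_normBounded_range hτ hN
      (@Continuous.comp _ _ _ _ _ τ _ _ (horb x) continuous_subtype_val) ⟨C * N x, ?_⟩
    rintro _ ⟨s, rfl⟩
    exact hC s (le_of_lt s.2) x

theorem locallyEquicont_mixedTopology (hτ : IsVectorTopology 𝕜 τ) (hN : seminormTopology N ≤ τ)
    (hT : ∀ t₀ : ℝ≥0, EquicontAtZero τ fun t : Set.Icc 0 t₀ => T t) (hb : LocallyBounded N T) :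
    LocallyEquicont (mixedTopology N τ) T := by
  intro t₀
  obtain ⟨C, hC⟩ := hb t₀
  refine equicont_mixedTopology hτ hN (abs_nonneg C) (fun t x => (hC t t.2.2 x).trans
    (mul_le_mul_of_nonneg_right (le_abs_self C) (apply_nonneg N x))) fun R U hU => ?_
  obtain ⟨V, hV, hVU⟩ := hT t₀ U hU
  exact ⟨V, hV, fun t x hx _ => hVU t x hx⟩

theorem eventually_sub_mem (hτ : IsVectorTopology 𝕜 τ) {t₀ : ℝ≥0}
    (hT : EquicontAtZero τ fun t : Set.Icc 0 t₀ => T t) {u : ℕ → X} {x : X}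
    (hu : Tendsto u atTop (@nhds X τ x)) {U : Set X} (hU : U ∈ @nhds X τ 0) :
    ∀ᶠ n in atTop, ∀ t ≤ t₀, T t (u n) - T t x ∈ U := by
  let := τ
  have := hτ.addGroup
  obtain ⟨V, hV, hVU⟩ := hT U hU
  have h : Tendsto (fun n => u n - x) atTop (𝓝 0) := by simpa using hu.sub_const x
  filter_upwards [h hV] with n hn t ht
  rw [← map_sub]
  exact hVU ⟨t, zero_le, ht⟩ _ hn

/-- A locally bounded, locally equicontinuous semigroup can be rescaled so that it stays locally
equicontinuous and its norm decays exponentially. -/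
theorem exists_rescaling (hτ : IsVectorTopology 𝕜 τ)
    (hT : ∀ t₀ : ℝ≥0, EquicontAtZero τ fun t : Set.Icc 0 t₀ => T t) (hb : LocallyBounded N T)
    (hadd : ∀ t s, T (t + s) = T t ∘ₗ T s) :
    ∃ M ω : ℝ, 0 ≤ M ∧
      (∀ t₀ : ℝ≥0, EquicontAtZero τ fun t : Set.Icc 0 t₀ =>
        ((Real.exp (-ω * (t : ℝ≥0)) : ℝ) : 𝕜) • T t) ∧
      ∀ (t : ℝ≥0) x, N ((((Real.exp (-ω * t) : ℝ) : 𝕜) • T t) x) ≤ M * Real.exp (-t) * N x := by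
  obtain ⟨M, ω, hM, hω, h⟩ := hb.exp_bounded hadd
  have hnorm : ∀ r : ℝ, ‖((Real.exp r : ℝ) : 𝕜)‖ = Real.exp r := fun r => by
    rw [RCLike.norm_ofReal, abs_of_pos (Real.exp_pos r)]
  -- With `ω + 1` in place of the growth exponent `ω`, a factor `e^{-t}` is left over.
  refine ⟨M, ω + 1, zero_le_one.trans hM, fun t₀ => (hT t₀).smul hτ fun t => ?_, fun t x => ?_⟩
  · rw [hnorm, Real.exp_le_one_iff]
    have := (t : ℝ≥0).coe_nonneg
    nlinarith
  · rw [LinearMap.smul_apply, map_smul_eq_mul, hnorm]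
    calc Real.exp (-(ω + 1) * t) * N (T t x)
        ≤ Real.exp (-(ω + 1) * t) * (M * Real.exp (ω * t) * N x) := by
          gcongr
          exact h t x
      _ = M * (Real.exp (-(ω + 1) * t) * Real.exp (ω * t)) * N x := by ring
      _ = M * Real.exp (-t) * N x := by
          rw [← Real.exp_add]
          ring_nf

theorem quasiEquicont_mixedTopology (hτ : IsVectorTopology 𝕜 τ) (hN : seminormTopology N ≤ τ)
    (hT : ∀ t₀ : ℝ≥0, EquicontAtZero τ fun t : Set.Icc 0 t₀ => T t) (hb : LocallyBounded N T)
    (hadd : ∀ t s, T (t + s) = T t ∘ₗ T s) :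
    QuasiEquicont (mixedTopology N τ) T := by
  obtain ⟨M, ω, hM, hS, hdec⟩ := exists_rescaling hτ hT hb hadd
  refine ⟨ω, equicont_mixedTopology hτ hN hM (fun t x => (hdec t x).trans ?_) fun R U hU =>
    equicont_on_ball_of_exp_decay hN hS hdec R hU⟩
  refine mul_le_mul_of_nonneg_right (mul_le_of_le_one_right hM ?_) (apply_nonneg N x)
  exact Real.exp_le_one_iff.2 (neg_nonpos.2 t.coe_nonneg)

theorem quasiEquitight (hτ : IsVectorTopology 𝕜 τ) (hN : seminormTopology N ≤ τ)
    (hT : ∀ t₀ : ℝ≥0, EquicontAtZero τ fun t : Set.Icc 0 t₀ => T t) (hb : LocallyBounded N T)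
    (hadd : ∀ t s, T (t + s) = T t ∘ₗ T s) : QuasiEquitight N τ T := by
  obtain ⟨M, ω, -, hS, hdec⟩ := exists_rescaling hτ hT hb hadd
  exact ⟨ω, equitight_of_exp_decay hτ hN hS hdec⟩

end Semigroup

end Abstract

/-! ### Weighted composition semigroups -/

section WeightedComposition

variable {𝕜 Ω : Type*} [RCLike 𝕜] [TopologicalSpace Ω]

theorem mem_nhds_coTopology_zero {F : Submodule 𝕜 C(Ω, 𝕜)} {U : Set F} :
    U ∈ @nhds F (coTopology F) 0 ↔
      ∃ K : Set Ω, IsCompact K ∧ ∃ ε > 0, ∀ f : F, (∀ x ∈ K, ‖(f : C(Ω, 𝕜)) x‖ < ε) → f ∈ U := by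
  have h1 : (𝓝 (0 : C(Ω, 𝕜))).HasBasis (fun p : Set Ω × ℝ => IsCompact p.1 ∧ 0 < p.2)
      fun p => {g | ∀ x ∈ p.1, ‖g x‖ < p.2} := by
    have h := nhds_basis_uniformity'
      (Metric.uniformity_basis_dist (α := 𝕜)).compactConvergenceUniformity
      (x := (0 : C(Ω, 𝕜)))
    simpa [UniformSpace.ball] using h
  rw [coTopology, nhds_induced, ZeroMemClass.coe_zero, (h1.comap _).mem_iff]
  simp [Set.subset_def, and_assoc]

variable {F : Submodule 𝕜 C(Ω, 𝕜)} {m : ℝ≥0 → C(Ω, 𝕜)} {φ : ℝ≥0 → C(Ω, Ω)}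
  {hF : ∀ t, ∀ f ∈ F, weightedComp (m t) (φ t) f ∈ F}

theorem weightedSemigroup_apply (t : ℝ≥0) (f : F) (x : Ω) :
    (weightedSemigroup F m φ hF t f : C(Ω, 𝕜)) x = m t x * (f : C(Ω, 𝕜)) (φ t x) := rfl

theorem weightedSemigroup_zero (hco : IsCoSemiflow m φ) :
    weightedSemigroup F m φ hF 0 = LinearMap.id := by
  ext f x
  simp [weightedSemigroup_apply, hco.semicocycle.zero, hco.semiflow.zero]

theorem weightedSemigroup_add (hco : IsCoSemiflow m φ) (t s : ℝ≥0) :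
    weightedSemigroup F m φ hF (t + s) =
      weightedSemigroup F m φ hF t ∘ₗ weightedSemigroup F m φ hF s := by
  ext f x
  rw [LinearMap.comp_apply, weightedSemigroup_apply, weightedSemigroup_apply,
    weightedSemigroup_apply, hco.semicocycle.add, add_comm t s, hco.semiflow.add, mul_assoc]

theorem continuous_weightedSemigroup_orbit (hm : JointlyContinuous m) (hφ : JointlyContinuous φ)
    (f : F) : @Continuous ℝ≥0 F _ (coTopology F) fun t => weightedSemigroup F m φ hF t f := by
  rw [coTopology, continuous_induced_rng]
  refine ContinuousMap.continuous_of_continuous_uncurry _ ?_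
  exact hm.mul ((f : C(Ω, 𝕜)).continuous.comp hφ)

/-- On `[0, t₀]` the values of `C_{m,φ}(t) f` on a compact set `K` are controlled by the values of
`f` on the compact set `φ([0, t₀] × K)` and by the bound of `m` on `[0, t₀] × K`. -/
theorem equicontAtZero_weightedSemigroup (hm : JointlyContinuous m) (hφ : JointlyContinuous φ)
    (t₀ : ℝ≥0) :
    EquicontAtZero (coTopology F) fun t : Set.Icc 0 t₀ => weightedSemigroup F m φ hF t := by
  intro U hU
  obtain ⟨K, hK, ε, hε, hKU⟩ := mem_nhds_coTopology_zero.1 hU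
  have hcpt : IsCompact (Set.Icc 0 t₀ ×ˢ K) := isCompact_Icc.prod hK
  obtain ⟨M, hM⟩ := hcpt.exists_bound_of_continuousOn (f := fun z : ℝ≥0 × Ω => m z.1 z.2)
    hm.continuousOn
  refine ⟨{f | ∀ y ∈ (fun z : ℝ≥0 × Ω => φ z.1 z.2) '' Set.Icc 0 t₀ ×ˢ K,
      ‖(f : C(Ω, 𝕜)) y‖ < ε / (|M| + 1)},
    mem_nhds_coTopology_zero.2 ⟨_, hcpt.image hφ, ε / (|M| + 1), by positivity, fun f hf => hf⟩,
    fun t f hf => hKU _ fun x hx => ?_⟩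
  have hz : ((t : ℝ≥0), x) ∈ Set.Icc 0 t₀ ×ˢ K := ⟨t.2, hx⟩
  rw [weightedSemigroup_apply, norm_mul]
  have h1 : ‖m t x‖ ≤ |M| + 1 := (hM _ hz).trans ((le_abs_self M).trans (by linarith))
  have h2 : ‖(f : C(Ω, 𝕜)) (φ t x)‖ < ε / (|M| + 1) := hf _ ⟨_, hz, rfl⟩
  calc ‖m t x‖ * ‖(f : C(Ω, 𝕜)) (φ t x)‖ ≤ (|M| + 1) * ‖(f : C(Ω, 𝕜)) (φ t x)‖ := by gcongr
    _ < ε := by rwa [mul_comm, ← lt_div_iff₀ (by positivity)]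

end WeightedComposition

end Saks

theorem mainTheorem1 {𝕜 Ω : Type*} [RCLike 𝕜] [TopologicalSpace Ω] [T2Space Ω]
    (F : Submodule 𝕜 C(Ω, 𝕜)) (N : Seminorm 𝕜 F)
    (hpre : Saks.IsPreSaks N (Saks.coTopology F))
    (m : ℝ≥0 → C(Ω, 𝕜)) (φ : ℝ≥0 → C(Ω, Ω)) (hco : Saks.IsCoSemiflow m φ)
    (hm : Saks.JointlyContinuous m) (hφ : Saks.JointlyContinuous φ)
    (hF : ∀ t, ∀ f ∈ F, Saks.weightedComp (m t) (φ t) f ∈ F)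
    (hbdd : Saks.LocallyBounded N (Saks.weightedSemigroup F m φ hF)) :
    (Saks.StronglyCont (Saks.mixedTopology N (Saks.coTopology F))
        (Saks.weightedSemigroup F m φ hF) ∧
      Saks.LocallyEquicont (Saks.coTopology F) (Saks.weightedSemigroup F m φ hF) ∧
      Saks.LocallyEquicont (Saks.mixedTopology N (Saks.coTopology F))
        (Saks.weightedSemigroup F m φ hF)) ∧
    (Saks.IsSaks N (Saks.coTopology F) →
      Saks.SeqComplete (Saks.mixedTopology N (Saks.coTopology F)) →
      Saks.IsBiContinuous N (Saks.coTopology F) (Saks.weightedSemigroup F m φ hF)) ∧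
    (Saks.IsSaks N (Saks.coTopology F) →
      Saks.SeqComplete (Saks.mixedTopology N (Saks.coTopology F)) →
      Saks.CSequential (Saks.mixedTopology N (Saks.coTopology F)) →
      Saks.QuasiEquicont (Saks.mixedTopology N (Saks.coTopology F))
        (Saks.weightedSemigroup F m φ hF)) ∧
    (Saks.IsSaks N (Saks.coTopology F) →
      Saks.SeqComplete (Saks.mixedTopology N (Saks.coTopology F)) →
      Saks.CSequential (Saks.mixedTopology N (Saks.coTopology F)) →
      (∃ Γ : Set (Seminorm 𝕜 F), Saks.IsSaksSystem N (Saks.coTopology F) Γ ∧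
        Saks.mixedTopology N (Saks.coTopology F) = Saks.submixedTopology Γ) →
      Saks.QuasiEquitight N (Saks.coTopology F) (Saks.weightedSemigroup F m φ hF)) := by
  have hτ := hpre.linear
  have hN := hpre.le
  have hloc := fun t₀ => Saks.equicontAtZero_weightedSemigroup (hF := hF) hm hφ t₀
  have hadd := Saks.weightedSemigroup_add (hF := hF) hco
  have horb := Saks.continuous_weightedSemigroup_orbit (hF := hF) hm hφ
  refine ⟨⟨Saks.stronglyCont_mixedTopology hτ hN hloc hbdd horb, fun t₀ => (hloc t₀).equicont hτ,
    Saks.locallyEquicont_mixedTopology hτ hN hloc hbdd⟩, fun _ _ => ?_, fun _ _ _ =>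
    Saks.quasiEquicont_mixedTopology hτ hN hloc hbdd hadd, fun _ _ _ _ =>
    Saks.quasiEquitight hτ hN hloc hbdd hadd⟩
  obtain ⟨M, ω, hM, -, hexp⟩ := hbdd.exp_bounded hadd
  exact ⟨Saks.weightedSemigroup_zero hco, hadd, ⟨M, ω, hM, hexp⟩, horb,
    fun t₀ u x _ hu U hU => Saks.eventually_sub_mem hτ (hloc t₀) hu hU⟩
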